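/- Let $X$ be a nonempty topological space (no separation axiom is assumed). For an infinite cardinal $\kappa$, the open-open game of length $\kappa$ on $X$ has one round for each ordinal $\alpha<\kappa$; in round $\alpha$ Player I, knowing the earlier choices $(B_\gamma)_{\gamma<\alpha}$ of Player II, chooses a nonempty open set $U_\alpha\subseteq X$, and then Player II chooses a nonempty open set $B_\alpha\subseteq U_\alpha$. Player I wins if $\bigcup_{\alpha<\kappa}B_\alpha$ is dense in $X$. The space $X$ is called $\kappa$-favorable if Player I has a winning strategy, that is, a function assigning to each sequence $(B_\gamma)_{\gamma<\alpha}$ of nonempty open sets with $\alpha<\kappa$ a nonempty open set, such that Player I wins every run in which each $U_\alpha$ is the value of this function at $(B_\gamma)_{\gamma<\alpha}$. Let $\mu(X)$ be the least infinite cardinal $\kappa$ such that $X$ is $\kappa$-favorable. For a topological space $Y$, let the cellularity $c(Y)$ be the least infinite cardinal $m$ such that every family of pairwise disjoint nonempty open subsets of $Y$ has cardinality at most $m$. If $\mu(X)=\kappa$, then for every set $I$ the product space $X^I$ satisfies $$c(X^I)\le\tau,\qquad\text{where}\quad \tau=\begin{cases}\kappa^{<\kappa}=\sup\{\kappa^{\lambda}:\lambda<\kappa,\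 \lambda\text{ a cardinal}\} & \text{if }\kappa\text{ is regular},\\ \kappa^{\kappa} & \text{otherwise.}\end{cases}$$ -/

import Mathlib

universe u v

/-- The nonempty open subsets of `X`: the legal moves of both players. -/
abbrev NonemptyOpens (X : Type u) [TopologicalSpace X] : Type u :=
  {U : Set X // IsOpen U ∧ U.Nonempty}

/-- A strategy of Player I in the open-open game of length `κ`: at each round `α < κ` it answers
the sequence `(B γ)_{γ < α}` of earlier choices of Player II by a nonempty open set. The rounds are
the ordinals below the initial ordinal `κ.ord` of `κ`. -/
abbrev OpenOpenStrategy (κ : Cardinal.{u}) (X : Type u) [TopologicalSpace X] : Type (u + 1) :=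
  (α : Set.Iio κ.ord) → (Set.Iio α → NonemptyOpens X) → NonemptyOpens X

/-- A strategy is winning if, for every run `B` of choices of Player II obeying the rules (the set
`B α` is contained in the move of Player I at round `α`), the union of these choices is dense. -/
def OpenOpenStrategy.IsWinning {κ : Cardinal.{u}} {X : Type u} [TopologicalSpace X]
    (s : OpenOpenStrategy κ X) : Prop :=
  ∀ B : Set.Iio κ.ord → NonemptyOpens X,
    (∀ α, (B α : Set X) ⊆ (s α (fun γ => B γ) : Set X)) →
      Dense (⋃ α, (B α : Set X))

/-- `X` is `κ`-favorable: Player I has a winning strategy in the open-open game of length `κ`. -/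
def IsFavorable (κ : Cardinal.{u}) (X : Type u) [TopologicalSpace X] : Prop :=
  ∃ s : OpenOpenStrategy κ X, s.IsWinning

/-- `μ(X)`, the least infinite cardinal `κ` such that `X` is `κ`-favorable (it exists as soon as
`X` is nonempty). -/
noncomputable def favorNumber (X : Type u) [TopologicalSpace X] : Cardinal.{u} :=
  sInf {κ : Cardinal.{u} | Cardinal.aleph0 ≤ κ ∧ IsFavorable κ X}

/-- The cellularity (Souslin number) `c(X)`: the least infinite cardinal `m` such that every family
of pairwise disjoint nonempty open subsets of `X` has cardinality at most `m`. -/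
noncomputable def cellularity (X : Type u) [TopologicalSpace X] : Cardinal.{u} :=
  sInf {m : Cardinal.{u} | Cardinal.aleph0 ≤ m ∧
    ∀ 𝒰 : Set (Set X), (∀ U ∈ 𝒰, IsOpen U ∧ U.Nonempty) → 𝒰.PairwiseDisjoint id →
      Cardinal.mk 𝒰 ≤ m}

open Classical in
/-- `τ(κ) = κ^{<κ}` (the supremum of `κ ^ c` over `c < κ`) if `κ` is regular, and `κ ^ κ`
otherwise. -/
noncomputable def tau (κ : Cardinal.{u}) : Cardinal.{u} :=
  if κ.IsRegular then Cardinal.powerlt κ κ else κ ^ κ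

/-! ### Cardinal arithmetic and closure under operations. -/

section CardinalArithmetic

open Cardinal

/-! Fix a disjoint family `𝒰`. For each finite list `l` of one-coordinate constraints met by some
member of `𝒰`, choose a member `V l` and a box inside `V l` satisfying `l`. As `tau κ` absorbs
exponents below `κ`, some set `S` of at most `tau κ` constraints is closed under this choice and
under Player I's strategy. Given `U ∈ 𝒰` and a box in `U` with sides `w i`,
`exists_forall_inter_nonempty` replaces `w i` by a side `W i` from `S` such that every side from `S`
below `W i` meets `w i`. For the list `l` of these `W i`, the chosen box meets the box of `U`, so `V
l = U` by disjointness. Thus `𝒰` injects into the finite lists over `S`. -/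

theorem aleph0_le_self_powerlt {κ : Cardinal.{u}} (h : ℵ₀ ≤ κ) : κ ≤ κ ^< κ := by
  simpa using le_powerlt κ (one_lt_aleph0.trans_le h)

/-- For regular `κ`, the cardinal `κ ^< κ` absorbs exponents below `κ`. -/
theorem powerlt_power_le_of_isRegular {κ c : Cardinal.{u}} (h : κ.IsRegular) (hc : c < κ) :
    (κ ^< κ) ^ c ≤ κ ^< κ := by
  set τ := κ ^< κ with hτ
  have hκτ : κ ≤ τ := aleph0_le_self_powerlt h.aleph0_le
  have hτ0 : ℵ₀ ≤ τ := h.aleph0_le.trans hκτ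
  induction c using Cardinal.inductionOn with | _ L
  -- By regularity, fewer than `κ` values below `κ ^< κ` all lie below a single `κ ^ d`.
  let A : Set.Iio κ → Set (L → Set.Iio τ.ord) := fun d => {f | ∀ l, (f l : Ordinal) < (κ ^ d.1).ord}
  have hA : ⋃ d, A d = Set.univ := by
    refine Set.eq_univ_of_forall fun f => Set.mem_iUnion.2 ?_
    have h1 : ∀ l, ∃ d : Set.Iio κ, (f l : Ordinal) < (κ ^ d.1).ord := by
      intro l
      have h2 : (f l : Ordinal).card < τ := Cardinal.lt_ord.1 (f l).2
      have : Nonempty (Set.Iio κ) := ⟨⟨0, h.pos⟩⟩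
      obtain ⟨d, hd⟩ := (lt_ciSup_iff bddAbove_of_small).1 (h2.trans_eq hτ)
      exact ⟨d, Cardinal.lt_ord.2 hd⟩
    choose d hd using h1
    have hsup : ⨆ l, (d l).1 < κ :=
      iSup_lt_of_lt_cof_ord (by rwa [h.cof_ord]) fun l => (d l).2
    refine ⟨⟨_, hsup⟩, fun l => (hd l).trans_le ?_⟩
    exact ord_le_ord.2 (power_le_power_left h.pos.ne'
      (le_ciSup (f := fun l => (d l).1) bddAbove_of_small l))
  have hAc : ∀ d, #(A d) ≤ lift.{u + 1} τ := by
    intro d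
    let g : A d → (L → Set.Iio (κ ^ d.1).ord) := fun f l => ⟨f.1 l, f.2 l⟩
    have hg : Function.Injective g := by
      intro f f' hff
      refine Subtype.ext (funext fun l => Subtype.ext ?_)
      exact congrArg (fun q : L → Set.Iio (κ ^ d.1).ord => (q l : Ordinal)) hff
    have h1 := mk_le_of_injective hg
    rw [mk_arrow, mk_Iio_ordinal, card_ord, lift_lift, ← lift_power, ← power_mul] at h1
    refine h1.trans ?_
    rw [lift_le]
    exact le_powerlt κ (mul_lt_of_lt h.aleph0_le d.2 hc)
  have hI : #(Set.Iio κ) ≤ lift.{u + 1} κ := by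
    let g : Set.Iio κ → Set.Iio κ.ord := fun d => ⟨d.1.ord, ord_lt_ord.2 d.2⟩
    have hg : Function.Injective g := by
      intro d d' hdd
      exact Subtype.ext (ord_injective (congrArg Subtype.val hdd))
    simpa using mk_le_of_injective hg
  have h3 : #(L → Set.Iio τ.ord) = lift.{u + 1} (τ ^ #L) := by
    simp [lift_power]
  rw [← lift_le.{u + 1}, ← h3, ← mk_univ, ← hA]
  refine (mk_iUnion_le_sum_mk).trans ((sum_le_sum _ (fun _ => lift.{u + 1} τ) hAc).trans ?_)
  rw [sum_const']
  refine (mul_le_mul' (hI.trans (lift_le.2 hκτ)) le_rfl).trans (mul_eq_self ?_).le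
  simpa using hτ0

theorem le_tau {κ : Cardinal.{u}} (h : ℵ₀ ≤ κ) : κ ≤ tau κ := by
  unfold tau
  split_ifs
  · exact aleph0_le_self_powerlt h
  · exact self_le_power κ (one_le_aleph0.trans h)

/-- With `le_tau`, this is all that the topological argument needs to know about `tau`. -/
theorem tau_power_le {κ c : Cardinal.{u}} (h : ℵ₀ ≤ κ) (hc : c < κ) : tau κ ^ c ≤ tau κ := by
  unfold tau
  split_ifs with hr
  · exact powerlt_power_le_of_isRegular hr hc
  · rw [← power_mul, mul_comm]
    exact power_le_power_left (aleph0_pos.trans_le h).ne'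
      ((mul_le_mul' hc.le le_rfl).trans (mul_eq_self h).le)

/-- Given operations `f a` on `C` of arity `β a`, there is a subset of `C` closed under all of them
whose size is at most any `κ` with `∑ a, κ ^ #(β a) ≤ κ`. -/
theorem exists_closed_card_le {A : Type u} {β : A → Type u} {C : Type v}
    (f : ∀ a, (β a → C) → C) {κ : Cardinal.{u}} (hκ : (sum fun a => κ ^ #(β a)) ≤ κ) :
    ∃ S : Set C, lift.{u} #S ≤ lift.{v} κ ∧ ∀ a b, (∀ i, b i ∈ S) → f a b ∈ S := by
  -- The closure consists of the values of well-founded terms.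
  let e : WType β → C := WType.elim C fun p => f p.1 p.2
  refine ⟨Set.range e, mk_range_le_lift.trans (lift_le.2 (WType.cardinalMk_le_of_le hκ)), ?_⟩
  intro a b hb
  choose t ht using hb
  exact ⟨WType.mk a t, congrArg (f a) (funext ht)⟩

/-- Given operations `f a` on `C` of arity `β a` and a map `G` from finite sequences in `C` to
countable subsets of `C`, there is a subset of `C` of size at most `κ` closed under both, provided
`κ` absorbs all arities. -/
theorem exists_closed_card_le_of_countable {A : Type u} {β : A → Type u} {C : Type v} [Nonempty C]
    (f : ∀ a, (β a → C) → C) (G : List C → Set C) (hG : ∀ l, (G l).Countable)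
    {κ : Cardinal.{u}} (h0 : ℵ₀ ≤ κ) (hA : #A ≤ κ) (hβ : ∀ a, κ ^ #(β a) ≤ κ) :
    ∃ S : Set C, lift.{u} #S ≤ lift.{v} κ ∧ (∀ a b, (∀ i, b i ∈ S) → f a b ∈ S) ∧
      ∀ l : List C, (∀ z ∈ l, z ∈ S) → G l ⊆ S := by
  have hg : ∀ l, ∃ g : ℕ → C, G l ⊆ Set.range g := fun l =>
    Set.countable_iff_exists_subset_range.1 (hG l)
  choose g hg using hg
  -- The pair `(n, k)` indexes the `n`-ary operation giving the `k`-th element of `G` on lists of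
  -- length `n`.
  let γ : A ⊕ ℕ × ℕ → Type u := Sum.elim β fun p => ULift (Fin p.1)
  let F : ∀ a, (γ a → C) → C := fun a => match a with
    | Sum.inl a => f a
    | Sum.inr p => fun b => g (List.ofFn fun i => b ⟨i⟩) p.2
  have hγ : ∀ a, κ ^ #(γ a) ≤ κ := by
    rintro (a | p)
    · exact hβ a
    · exact (by simpa [γ] using power_nat_le (n := p.1) h0)
  obtain ⟨S, hS, hcl⟩ := exists_closed_card_le F (κ := κ) <| by
    refine (sum_le_sum _ (fun _ => κ) hγ).trans ?_
    rw [sum_const', mk_sum]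
    refine (mul_le_mul' (add_le_of_le h0 (by simpa using hA) (by simpa using h0)) le_rfl).trans
      (mul_eq_self h0).le
  refine ⟨S, hS, fun a b hb => hcl (Sum.inl a) b hb, fun l hl z hz => ?_⟩
  obtain ⟨k, rfl⟩ := hg l hz
  simpa [F] using hcl (Sum.inr (l.length, k)) (fun i => l.get i.down)
    fun i => hl _ (l.get_mem i.down)

end CardinalArithmetic

/-! ### The open-open game. -/

section Game

open Cardinal

/-- A family closed under a winning strategy of Player I is a complete subfamily: below some member
of it, all members meet a given nonempty open set. -/
theorem OpenOpenStrategy.IsWinning.exists_forall_inter_nonempty {κ : Cardinal.{u}} {X : Type u}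
    [TopologicalSpace X] {s : OpenOpenStrategy κ X} (hs : s.IsWinning)
    {P : Set (NonemptyOpens X)} (hP : ∀ α b, (∀ γ, b γ ∈ P) → s α b ∈ P)
    {V : Set X} (hV : IsOpen V) (hne : V.Nonempty) :
    ∃ W ∈ P, ∀ U ∈ P, (U : Set X) ⊆ W → ((U : Set X) ∩ V).Nonempty := by
  by_contra! hcon
  choose! r hrP hrW hrV using hcon
  -- Player II always answers with `r`, which stays in `P` and avoids `V`, so the union is not
  -- dense.
  let B : Set.Iio κ.ord → NonemptyOpens X := (wellFounded_lt (α := Set.Iio κ.ord)).fix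
    fun α ih => r (s α fun γ => ih γ.1 γ.2)
  have hB : ∀ α, B α = r (s α fun γ => B γ.1) := fun α => WellFounded.fix_eq _ _ _
  have hsP : ∀ α, s α (fun γ => B γ.1) ∈ P := by
    intro α
    induction α using WellFoundedLT.induction with
    | _ α ih =>
      refine hP _ _ fun γ => ?_
      rw [hB]
      exact hrP _ (ih γ.1 γ.2)
  obtain ⟨x, hxV, hx⟩ := (hs B fun α => by
    have h := hrW _ (hsP α)
    rw [← hB] at h
    exact h).inter_open_nonempty V hV hne
  obtain ⟨α, hα⟩ := Set.mem_iUnion.1 hx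
  rw [hB] at hα
  exact (hrV _ (hsP α)).subset ⟨hα, hxV⟩

/-- In a long enough game Player I can simply list all nonempty open sets, ignoring Player II. -/
theorem exists_isFavorable (X : Type u) [TopologicalSpace X] [Nonempty X] :
    ∃ κ : Cardinal.{u}, ℵ₀ ≤ κ ∧ IsFavorable κ X := by
  let κ := max ℵ₀ #(NonemptyOpens X)
  have : Nonempty (NonemptyOpens X) := ⟨⟨Set.univ, isOpen_univ, Set.univ_nonempty⟩⟩
  have h : lift.{u + 1} #(NonemptyOpens X) ≤ lift.{u} #(Set.Iio κ.ord) := by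
    simp [κ]
  obtain ⟨e⟩ := lift_mk_le'.1 h
  refine ⟨κ, le_max_left _ _, fun α _ => Function.invFun e α, fun B hB => ?_⟩
  refine dense_iff_inter_open.2 fun V hV hne => ?_
  have h1 := hB (e ⟨V, hV, hne⟩)
  simp only [Function.leftInverse_invFun e.injective _] at h1
  obtain ⟨x, hx⟩ := (B (e ⟨V, hV, hne⟩)).2.2
  exact ⟨x, h1 hx, Set.mem_iUnion.2 ⟨_, hx⟩⟩

theorem favorNumber_spec (X : Type u) [TopologicalSpace X] [Nonempty X] :
    ℵ₀ ≤ favorNumber X ∧ IsFavorable (favorNumber X) X :=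
  csInf_mem (exists_isFavorable X)

end Game

/-! ### Cellular families in powers. -/

section Product

open Cardinal

/-- The open box in `I → X` cut out by finitely many one-coordinate constraints. -/
def constraintBox {X : Type u} [TopologicalSpace X] {I : Type v}
    (l : List (NonemptyOpens X × I)) : Set (I → X) :=
  {x | ∀ z ∈ l, x z.2 ∈ (z.1 : Set X)}

theorem isOpen_constraintBox {X : Type u} [TopologicalSpace X] {I : Type v}
    (l : List (NonemptyOpens X × I)) : IsOpen (constraintBox l) := by
  have h : constraintBox l = ⋂ z ∈ {z | z ∈ l}, (fun x : I → X => x z.2) ⁻¹' (z.1 : Set X) := by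
    ext x
    simp [constraintBox]
  rw [h]
  exact l.finite_toSet.isOpen_biInter fun z _ => z.1.2.1.preimage (continuous_apply z.2)

/-- Two nonempty boxes in a power intersect as soon as they do so on each common coordinate. -/
theorem exists_mem_pi_inter_pi {X : Type u} {I : Type v} {F G : Set I} {a b : I → Set X}
    {x y : I → X} (hx : x ∈ F.pi a) (hy : y ∈ G.pi b)
    (h : ∀ i ∈ F, i ∈ G → (a i ∩ b i).Nonempty) : (F.pi a ∩ G.pi b).Nonempty := by
  classical
  choose p hp using h
  refine ⟨fun i => if hF : i ∈ F then if hG : i ∈ G then p i hF hG else x i else y i,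
    fun i hi => ?_, fun i hi => ?_⟩
  · by_cases hG : i ∈ G
    · simpa [hi, hG] using (hp i hi hG).1
    · simpa [hi, hG] using hx i hi
  · by_cases hF : i ∈ F
    · simpa [hi, hF] using (hp i hF hi).2
    · simpa [hi, hF] using hy i hi

/-- In a power of a `κ`-favorable space every cellular family has size at most `tau κ`. -/
theorem IsFavorable.mk_le_lift_tau {X : Type u} [TopologicalSpace X] {κ : Cardinal.{u}}
    (h0 : ℵ₀ ≤ κ) (hfav : IsFavorable κ X) [Nonempty X] {I : Type v} [Nonempty I]
    {𝒰 : Set (Set (I → X))} (hU : ∀ U ∈ 𝒰, IsOpen U ∧ U.Nonempty) (hd : 𝒰.PairwiseDisjoint id) :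
    #𝒰 ≤ lift.{v} (tau κ) := by
  classical
  obtain ⟨s, hs⟩ := hfav
  let C := NonemptyOpens X × I
  have hC : Nonempty C :=
    ⟨⟨⟨Set.univ, isOpen_univ, Set.univ_nonempty⟩, Classical.arbitrary I⟩⟩
  -- below every finite system of constraints compatible with `𝒰`, choose a member and a box in it
  have hM : ∀ l : List C, ∃ V : Set (I → X), ∃ F : Finset I, ∃ u : I → NonemptyOpens X,
      ∃ y : I → X, (∃ U ∈ 𝒰, (U ∩ constraintBox l).Nonempty) →
        V ∈ 𝒰 ∧ y ∈ (F : Set I).pi (fun i => (u i : Set X)) ∧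
          (F : Set I).pi (fun i => (u i : Set X)) ⊆ V ∩ constraintBox l := by
    intro l
    by_cases h : ∃ U ∈ 𝒰, (U ∩ constraintBox l).Nonempty
    · obtain ⟨V, hV, y, hy⟩ := h
      obtain ⟨F, u, hu, hsub⟩ :=
        isOpen_pi_iff.1 ((hU V hV).1.inter (isOpen_constraintBox l)) y hy
      refine ⟨V, F, fun i => if hi : i ∈ F then ⟨u i, (hu i hi).1, _, (hu i hi).2⟩ else
        ⟨Set.univ, isOpen_univ, Set.univ_nonempty⟩, y, fun _ => ⟨hV, fun i hi => ?_, fun x hx => ?_⟩⟩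
      · simpa [Finset.mem_coe.1 hi] using (hu i hi).2
      · refine hsub fun i hi => ?_
        simpa [Finset.mem_coe.1 hi] using hx i hi
    · exact ⟨∅, ∅, fun _ => hC.some.1, Classical.arbitrary _, fun h' => (h h').elim⟩
  choose V F u y hM using hM
  let T : Cardinal.{u + 1} := lift.{u + 1} (tau κ)
  have hT : ℵ₀ ≤ T := by simpa [T] using h0.trans (le_tau h0)
  obtain ⟨S, hScard, hSs, hSG⟩ := exists_closed_card_le_of_countable (C := C) (κ := T)
    (A := Set.Iio κ.ord) (β := fun α => Set.Iio α)
    (fun α b => (s α fun γ => (b γ).1, Classical.arbitrary I))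
    -- The recombined pairs make `S` the full product of its projections `P` and `J`.
    (fun l => {z | ∃ a ∈ l, ∃ b ∈ l, z = (a.1, b.2)} ∪ (fun i => (u l i, i)) '' (F l : Set I))
    (fun l => by
      refine Set.Finite.countable (.union ?_ ((F l).finite_toSet.image _))
      refine (((l.finite_toSet.prod l.finite_toSet).image fun p : C × C => (p.1.1, p.2.2))).subset ?_
      rintro z ⟨a, ha, b, hb, rfl⟩
      exact ⟨(a, b), ⟨ha, hb⟩, rfl⟩)
    hT (by simpa [T] using le_tau h0) (fun α => by
      let g : Set.Iio α → Set.Iio (α : Ordinal) := fun γ => ⟨γ.1, γ.2⟩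
      have hg : Function.Injective g := fun γ γ' h =>
        Subtype.ext <| Subtype.ext <| congrArg
          (fun q : Set.Iio (α : Ordinal) => (q : Ordinal)) h
      have h1 := mk_le_of_injective hg
      rw [mk_Iio_ordinal] at h1
      refine (power_le_power_left (aleph0_pos.trans_le hT).ne' h1).trans ?_
      rw [← lift_power, lift_le]
      exact tau_power_le h0 (Cardinal.lt_ord.1 α.2))
  have hS : #S ≤ lift.{v} (tau κ) := by
    rw [← lift_le.{u + 1}]
    simpa [T] using hScard
  let P : Set (NonemptyOpens X) := Prod.fst '' S
  let J : Set I := Prod.snd '' S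
  have hPJ : ∀ U ∈ P, ∀ i ∈ J, (U, i) ∈ S := by
    rintro _ ⟨a, ha, rfl⟩ _ ⟨b, hb, rfl⟩
    exact hSG [a, b] (by simp [ha, hb]) (Or.inl ⟨a, by simp, b, by simp, rfl⟩)
  have hP : ∀ α b, (∀ γ, b γ ∈ P) → s α b ∈ P := by
    intro α b hb
    choose c hc hcb using hb
    obtain rfl : (fun γ => (c γ).1) = b := funext hcb
    exact ⟨_, hSs α c hc, rfl⟩
  have hF : ∀ l : List C, (∀ z ∈ l, z ∈ S) → ∀ i ∈ F l, u l i ∈ P ∧ i ∈ J := by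
    intro l hl i hi
    have h := hSG l hl (Or.inr ⟨i, hi, rfl⟩)
    exact ⟨⟨_, h, rfl⟩, ⟨_, h, rfl⟩⟩
  -- every member of `𝒰` is the one chosen for a suitable finite list from `S`
  have key : ∀ U ∈ 𝒰, ∃ l : List S, V (l.map Subtype.val) = U := by
    intro U hUU
    obtain ⟨hUo, x, hx⟩ := hU U hUU
    obtain ⟨E, w, hw, hE⟩ := isOpen_pi_iff.1 hUo x hx
    have hW : ∀ i, ∃ W, i ∈ E → W ∈ P ∧ ∀ U' ∈ P, (U' : Set X) ⊆ W →
        ((U' : Set X) ∩ w i).Nonempty := by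
      intro i
      by_cases hi : i ∈ E
      · obtain ⟨W, hW, h⟩ := hs.exists_forall_inter_nonempty hP (hw i hi).1 ⟨_, (hw i hi).2⟩
        exact ⟨W, fun _ => ⟨hW, h⟩⟩
      · exact ⟨hC.some.1, fun h => (hi h).elim⟩
    choose W hW using hW
    -- Coordinates of `E` outside `J` need no constraint: `F l` lies in `J` and never contains them.
    let l : List C := (E.filter (· ∈ J)).toList.map fun i => (W i, i)
    have hl : ∀ z, z ∈ l ↔ ∃ i, (i ∈ E ∧ i ∈ J) ∧ (W i, i) = z := by
      intro z
      simp [l]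
    have hlS : ∀ z ∈ l, z ∈ S := by
      intro z hz
      obtain ⟨i, ⟨hi, hiJ⟩, rfl⟩ := (hl z).1 hz
      exact hPJ _ (hW i hi).1 i hiJ
    have hmeet : (U ∩ constraintBox l).Nonempty := by
      have h2 : ∀ i ∈ E, ((W i : Set X) ∩ w i).Nonempty := fun i hi =>
        (hW i hi).2 _ (hW i hi).1 subset_rfl
      choose! q hq using h2
      refine ⟨fun i => if i ∈ E then q i else x i, hE fun i hi => ?_, fun z hz => ?_⟩
      · simpa [Finset.mem_coe.1 hi] using (hq i hi).2
      · obtain ⟨i, ⟨hi, hiJ⟩, rfl⟩ := (hl z).1 hz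
        simpa [hi] using (hq i hi).1
    obtain ⟨hV, hy, hsub⟩ := hM l ⟨U, hUU, hmeet⟩
    have hcommon : ∀ i ∈ (F l : Set I), i ∈ (E : Set I) → ((u l i : Set X) ∩ w i).Nonempty := by
      intro i hi hiE
      obtain ⟨huP, hiJ⟩ := hF l hlS i hi
      refine (hW i hiE).2 _ huP fun p hp => ?_
      -- Moving one coordinate of `y l` within the chosen box shows that `u l i` lies inside `W i`.
      have h3 : Function.update (y l) i p ∈ (F l : Set I).pi (fun i => (u l i : Set X)) := by
        intro j hj
        by_cases hji : j = i
        · subst hji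
          simpa using hp
        · simpa [hji] using hy j hj
      simpa using (hsub h3).2 (W i, i) ((hl _).2 ⟨i, ⟨hiE, hiJ⟩, rfl⟩)
    obtain ⟨p, hp1, hp2⟩ := exists_mem_pi_inter_pi hy (fun i hi => (hw i hi).2) hcommon
    have hVU : V l = U := by
      by_contra hne
      exact Set.disjoint_left.1 (hd hV hUU hne) (hsub hp1).1 (hE hp2)
    refine ⟨l.attach.map fun z => ⟨z.1, hlS z.1 z.2⟩, ?_⟩
    simpa [List.map_map, Function.comp_def] using hVU
  choose! L hL using key
  have hinj : Function.Injective fun U : 𝒰 => L U := by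
    intro U U' h
    apply Subtype.ext
    rw [← hL U U.2, ← hL U' U'.2]
    exact congrArg (fun t : List S => V (t.map Subtype.val)) h
  refine (mk_le_of_injective hinj).trans ((mk_list_le_max _).trans (max_le ?_ hS))
  simpa using h0.trans (le_tau h0)

end Product

theorem corollary4p7 (X : Type u) [TopologicalSpace X] [Nonempty X] (κ : Cardinal.{u})
    (hκ : favorNumber X = κ) (I : Type v) :
    cellularity (I → X) ≤ Cardinal.lift.{v} (tau κ) := by
  subst hκ
  obtain ⟨h0, hfav⟩ := favorNumber_spec X
  have hτ : Cardinal.aleph0 ≤ Cardinal.lift.{v} (tau (favorNumber X)) := by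
    simpa using h0.trans (le_tau h0)
  refine csInf_le' ⟨hτ, fun 𝒰 hU hd => ?_⟩
  cases isEmpty_or_nonempty I
  · exact Cardinal.mk_le_aleph0.trans hτ
  · exact hfav.mk_le_lift_tau h0 hU hd
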